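/- Let $O(3)$ be the group of orthogonal transformations of $\mathbb{R}^3$, and let $D_{\infty h}\le O(3)$ be the subgroup of all elements that map the $z$-axis to itself; every conjugate of it in $O(3)$ (the same group for another axis) is also said to be a $D_{\infty h}$. A point group is a finite subgroup of $O(3)$. A subgroup $S$ of a group $N$ has a complement in $N$ if there is a subgroup $H\le N$ with $S\cap H=\{e\}$ and $N=SH$. If a group $G$ acts on a set $X$ and $S\le G$, an ideal $G$-equivariant symmetry breaking set (SBS) for $S$ is a nonempty subset $B\subseteq X$ on which $S$ acts freely and transitively and which satisfies $gB=B$ for all $g$ in the normalizer $N_G(S)$. Theorem. Let $A$ be a point group whose normalizer $N_{O(3)}(A)$ is a $D_{\infty h}$, and suppose that $A$ contains a rotation (an element of determinant $1$) other than the identity. Then $A$ has no complement in $N_{O(3)}(A)$. Consequently, no set with an action of $O(3)$ contains an ideal $O(3)$-equivariant SBS for $A$. Moreover, the point groups $A$ that satisfy these hypotheses are exactly the conjugates in $O(3)$ of the groups $C_n$, $S_{2n}$ and $C_{nh}$ with $n\ge 2$. Here $C_n$ is generated by the rotation by $2\pi/n$ about the $z$-axis, $S_{2n}$ by the rotation by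 $2\pi/(2n)$ about the $z$-axis composed with the reflection $\sigma_h$ in the $xy$-plane, and $C_{nh}$ by $C_n$ and $\sigma_h$. -/

import Mathlib

open scoped Pointwise

universe u v

/-! ### Symmetry breaking sets -/

section SymmetryBreaking

variable {G : Type u} [Group G] {X : Type v} [MulAction G X]

/-- `B` is a symmetry breaking set for `S`: the group `S` acts on `B`, and this action is free. -/
structure IsSBS (S : Subgroup G) (B : Set X) : Prop where
  smul_mem : ∀ s ∈ S, ∀ b ∈ B, s • b ∈ B
  free : ∀ s ∈ S, ∀ b ∈ B, s • b = b → s = 1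

/-- `B` is a `G`-equivariant symmetry breaking set for `S`: it is closed under the normalizer
of `S` in `G`. -/
structure IsEquivariantSBS (S : Subgroup G) (B : Set X) : Prop extends IsSBS S B where
  smul_eq : ∀ g ∈ Subgroup.normalizer (S : Set G), g • B = B

/-- `B` is an ideal `G`-equivariant symmetry breaking set for `S`: the group `S` acts transitively
on `B`, that is, `B` consists of exactly one `S`-orbit (so it is not empty). -/
structure IsIdealEquivariantSBS (S : Subgroup G) (B : Set X) : Prop
    extends IsEquivariantSBS S B where
  nonempty : B.Nonempty
  transitive : ∀ b ∈ B, ∀ b' ∈ B, ∃ s ∈ S, s • b = b'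

/-- `S` has a complement in `N` (used for `S ≤ N`): there is a subgroup `H` of `N` such that every
element of `N` is uniquely a product `s * h` with `s ∈ S` and `h ∈ H`. -/
def HasComplementIn (S N : Subgroup G) : Prop :=
  ∃ H : Subgroup N, Subgroup.IsComplement' (S.subgroupOf N) H

/-- `H` is a conjugate of `K`. In `O(3)`: the two have the same Schönflies symbol. -/
def IsConjugateTo (H K : Subgroup G) : Prop :=
  ∃ g : G, H = MulAut.conj g • K

end SymmetryBreaking

/-! ### Subgroups of `O(3)`, in Schönflies notation, with the `z`-axis as the main axis -/

noncomputable section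

namespace Schoenflies

/-- The group `O(3)`, that is, `K_h`. -/
abbrev O3 : Type := Matrix.orthogonalGroup (Fin 3) ℝ

/-- The unit vector on the `z`-axis. -/
def ez : Fin 3 → ℝ := ![0, 0, 1]

/-- `D_∞h`: all the orthogonal transformations that map the `z`-axis to itself. -/
def Dinfh : Subgroup O3 where
  carrier := {g | g.1.mulVec ez = ez ∨ g.1.mulVec ez = -ez}
  one_mem' := by simp
  mul_mem' := by
    rintro a b (ha | ha) (hb | hb) <;>
      simp [← Matrix.mulVec_mulVec, Matrix.mulVec_neg, ha, hb]
  inv_mem' := by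
    intro a ha
    have h : (a⁻¹).1.mulVec (a.1.mulVec ez) = ez := by
      rw [Matrix.mulVec_mulVec, ← Submonoid.coe_mul]
      simp
    rcases ha with ha | ha <;> rw [ha] at h
    · exact Or.inl h
    · rw [Matrix.mulVec_neg] at h
      exact Or.inr (neg_eq_iff_eq_neg.mp h)

/-- The rotation by the angle `θ` about the `z`-axis. -/
def rotZ (θ : ℝ) : O3 :=
  ⟨!![Real.cos θ, -Real.sin θ, 0; Real.sin θ, Real.cos θ, 0; 0, 0, 1], by
    rw [Matrix.mem_orthogonalGroup_iff]
    ext i j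
    have h := Real.sin_sq_add_cos_sq θ
    fin_cases i <;> fin_cases j <;>
      simp [Matrix.mul_apply, Fin.sum_univ_three] <;> linarith⟩

/-- The reflection `σ_h` in the plane orthogonal to the `z`-axis. -/
def sigmaH : O3 :=
  ⟨!![1, 0, 0; 0, 1, 0; 0, 0, -1], by
    rw [Matrix.mem_orthogonalGroup_iff]
    ext i j
    fin_cases i <;> fin_cases j <;>
      simp [Matrix.mul_apply, Fin.sum_univ_three]⟩

/-- `C_n`, generated by the rotation by `2π/n`. -/
def C (n : ℕ) : Subgroup O3 := Subgroup.zpowers (rotZ (2 * Real.pi / n))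

/-- `S_m`, generated by the rotoreflection by `2π/m`. -/
def S (m : ℕ) : Subgroup O3 := Subgroup.zpowers (sigmaH * rotZ (2 * Real.pi / m))

/-- `C_nh`, generated by `C_n` and the reflection `σ_h`. -/
def Ch (n : ℕ) : Subgroup O3 := C n ⊔ Subgroup.zpowers sigmaH

/-- `A` contains a pure rotation (an element of `SO(3)`) other than the identity. -/
def HasNontrivialRotation (A : Subgroup O3) : Prop :=
  ∃ a ∈ A, a.1.det = 1 ∧ a ≠ 1

end Schoenflies

end

/-! Conjugation reduces everything to the `z`-axis. If the normalizer is `Dinfh`, then `A` lies in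
`Cinfh`: conjugating some `k * sigmaV` in `A` by all rotations about the axis would put every such
rotation into the finite group `A` (`le_Cinfh_of_normalizer_eq`). Hence rotations about the axis
centralize `A`, and a nontrivial rotation in `A` has a root of order `|A|` among them. If that root
is `s * h` with `s` in `A` and `h` in a complement, its `|A|`-th power is `h ^ |A|`, a nontrivial
element of both subgroups (`not_hasComplementIn_of_root`). An ideal SBS is excluded because its
point stabilizers are complements.

Conversely, `Dinfh` normalizes each subgroup of `Cinfh`, and a nontrivial rotation in the subgroup
pins down the axis, so the normalizer is no larger (`normalizer_eq_Dinfh`). It remains to list the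
finite subgroups of `Cinfh` (`eq_C_or_S_or_Ch`): the rotations form some `C n`, and the angle of one
improper element, a multiple of `π / n`, decides the type by parity. -/

section Complements

variable {G : Type u} [Group G]

/-! ### Conjugation, complements and symmetry breaking sets -/

theorem conj_smul_normalizer (g : G) (A : Subgroup G) :
    Subgroup.normalizer ((MulAut.conj g • A : Subgroup G) : Set G) =
      MulAut.conj g • Subgroup.normalizer (A : Set G) :=
  (Subgroup.map_equiv_normalizer_eq A (MulAut.conj g)).symm

theorem conj_smul_eq_iff (g : G) (A B : Subgroup G) :
    A = MulAut.conj g • B ↔ MulAut.conj g⁻¹ • A = B := by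
  rw [map_inv, inv_smul_eq_iff]

theorem mem_conj_inv_smul_iff {g x : G} {A : Subgroup G} :
    x ∈ MulAut.conj g⁻¹ • A ↔ g * x * g⁻¹ ∈ A := by
  rw [Subgroup.mem_pointwise_smul_iff_inv_smul_mem, map_inv, inv_inv, MulAut.smul_def,
    MulAut.conj_apply]

theorem pow_card_eq_one_of_mem {A : Subgroup G} {s : G} (hs : s ∈ A) : s ^ Nat.card A = 1 :=
  congrArg Subtype.val (pow_card_eq_one' (x := (⟨s, hs⟩ : A)))

/-- A finite subgroup has no complement in `N` if one of its nontrivial elements has a root of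
order `|A|` in `N` which centralizes `A`. -/
theorem not_hasComplementIn_of_root {A N : Subgroup G} [Finite A] (hAN : A ≤ N) {a r : G}
    (ha : a ∈ A) (ha1 : a ≠ 1) (hr : r ∈ N) (hra : r ^ Nat.card A = a)
    (hc : ∀ s ∈ A, Commute r s) : ¬ HasComplementIn A N := by
  rintro ⟨H, hH⟩
  obtain ⟨⟨⟨s, hs⟩, ⟨h, hh⟩⟩, hsh⟩ := hH.2 ⟨r, hr⟩
  have hs' : (s : G) ∈ A := hs
  have hsh' : (s : G) * h = r := congrArg Subtype.val hsh
  have hh' : (h : G) = (s : G)⁻¹ * r := by rw [← hsh']; group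
  have hpow : (h : G) ^ Nat.card A = a := by
    rw [hh', (((hc s hs').symm).inv_left).mul_pow, hra, inv_pow]
    rw [pow_card_eq_one_of_mem hs', inv_one, one_mul]
  have hmem : (⟨a, hAN ha⟩ : N) ∈ H := by
    have h1 := H.pow_mem hh (Nat.card A)
    have h2 : h ^ Nat.card A = (⟨a, hAN ha⟩ : N) := Subtype.ext (by simpa using hpow)
    rwa [h2] at h1
  have h3 : (⟨a, hAN ha⟩ : N) ∈ A.subgroupOf N := ha
  have h4 := Subgroup.disjoint_def.1 hH.disjoint h3 hmem
  exact ha1 (congrArg Subtype.val h4)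

/-- An ideal equivariant symmetry breaking set yields a complement in the normalizer, namely the
stabilizer of one of its points. -/
theorem IsIdealEquivariantSBS.hasComplementIn {X : Type v} [MulAction G X] {A : Subgroup G}
    {B : Set X} (hB : IsIdealEquivariantSBS A B) :
    HasComplementIn A (Subgroup.normalizer (A : Set G)) := by
  obtain ⟨b, hb⟩ := hB.nonempty
  refine ⟨MulAction.stabilizer (Subgroup.normalizer (A : Set G)) b,
    Subgroup.isComplement'_of_disjoint_and_mul_eq_univ ?_ ?_⟩
  · rw [Subgroup.disjoint_def]
    intro x hx hxb
    exact Subtype.ext (hB.free x hx b hb hxb)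
  · refine Set.eq_univ_of_forall fun x => ?_
    have hxb : (x : G) • b ∈ B := by
      rw [← hB.smul_eq x x.2]
      exact Set.smul_mem_smul_set hb
    obtain ⟨s, hs, hsb⟩ := hB.transitive b hb _ hxb
    refine Set.mem_mul.2 ⟨⟨s, Subgroup.le_normalizer hs⟩, hs,
      (⟨s, Subgroup.le_normalizer hs⟩ : Subgroup.normalizer (A : Set G))⁻¹ * x, ?_, by group⟩
    change (s⁻¹ * (x : G)) • b = b
    rw [mul_smul, ← hsb, inv_smul_smul]

end Complements

namespace Schoenflies

/-! ### Rotations and reflections as matrices -/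

theorem O3.ext {g h : O3} (H : ∀ i j, g.1 i j = h.1 i j) : g = h :=
  Subtype.ext (Matrix.ext H)

theorem rotZ_add (θ φ : ℝ) : rotZ (θ + φ) = rotZ θ * rotZ φ := by
  refine O3.ext fun i j => ?_
  fin_cases i <;> fin_cases j <;>
    simp [rotZ, Real.cos_add, Real.sin_add] <;> ring

theorem rotZ_zero : rotZ 0 = 1 := by
  refine O3.ext fun i j => ?_
  fin_cases i <;> fin_cases j <;> simp [rotZ]

theorem rotZ_neg (θ : ℝ) : rotZ (-θ) = (rotZ θ)⁻¹ := by
  rw [eq_inv_iff_mul_eq_one, ← rotZ_add, neg_add_cancel, rotZ_zero]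

theorem rotZ_commute (θ φ : ℝ) : Commute (rotZ θ) (rotZ φ) := by
  rw [Commute, SemiconjBy, ← rotZ_add, ← rotZ_add, add_comm]

theorem rotZ_pow (θ : ℝ) (n : ℕ) : rotZ θ ^ n = rotZ (n * θ) := by
  induction n with
  | zero => simp [rotZ_zero]
  | succ n ih => rw [pow_succ, ih, ← rotZ_add]; congr 1; push_cast; ring

theorem rotZ_zpow (θ : ℝ) (k : ℤ) : rotZ θ ^ k = rotZ (k * θ) := by
  cases k with
  | ofNat n => simp [rotZ_pow]
  | negSucc n =>
    rw [zpow_negSucc, rotZ_pow, ← rotZ_neg]; congr 1; push_cast; ring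

theorem rotZ_eq_one_iff_cos {θ : ℝ} : rotZ θ = 1 ↔ Real.cos θ = 1 := by
  constructor
  · intro h
    have := congrArg (fun g : O3 => g.1 0 0) h
    simpa [rotZ] using this
  · intro h
    have hs : Real.sin θ = 0 := by
      have := Real.sin_sq_add_cos_sq θ
      rw [h] at this
      nlinarith
    refine O3.ext fun i j => ?_
    fin_cases i <;> fin_cases j <;> simp [rotZ, h, hs]

theorem rotZ_eq_one_iff {θ : ℝ} : rotZ θ = 1 ↔ ∃ k : ℤ, (k : ℝ) * (2 * Real.pi) = θ := by
  rw [rotZ_eq_one_iff_cos, Real.cos_eq_one_iff]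

theorem rotZ_pi_ne_one : rotZ Real.pi ≠ 1 := by
  rw [Ne, rotZ_eq_one_iff_cos, Real.cos_pi]
  norm_num

theorem sigmaH_mul_self : sigmaH * sigmaH = 1 := by
  refine O3.ext fun i j => ?_
  fin_cases i <;> fin_cases j <;> simp [sigmaH]

theorem sigmaH_inv : sigmaH⁻¹ = sigmaH := inv_eq_of_mul_eq_one_left sigmaH_mul_self

theorem rotZ_commute_sigmaH (θ : ℝ) : Commute (rotZ θ) sigmaH := by
  refine O3.ext fun i j => ?_
  fin_cases i <;> fin_cases j <;> simp [rotZ, sigmaH]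

theorem det_rotZ (θ : ℝ) : (rotZ θ).1.det = 1 := by
  have := Real.sin_sq_add_cos_sq θ
  simp [rotZ, Matrix.det_fin_three]
  linarith

theorem det_sigmaH : sigmaH.1.det = -1 := by
  simp [sigmaH, Matrix.det_fin_three]

theorem det_rotZ_mul_sigmaH (θ : ℝ) : (rotZ θ * sigmaH).1.det = -1 := by
  rw [Submonoid.coe_mul, Matrix.det_mul, det_rotZ, det_sigmaH, one_mul]

theorem det_conj (g x : O3) : (g * x * g⁻¹).1.det = x.1.det := by
  have h : g.1.det * (g⁻¹).1.det = 1 := by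
    rw [← Matrix.det_mul, ← Submonoid.coe_mul, mul_inv_cancel]
    simp
  rw [Submonoid.coe_mul, Submonoid.coe_mul, Matrix.det_mul, Matrix.det_mul]
  linear_combination x.1.det * h

/-- The reflection in the `xz`-plane. -/
def sigmaV : O3 :=
  ⟨!![1, 0, 0; 0, -1, 0; 0, 0, 1], by
    rw [Matrix.mem_orthogonalGroup_iff]
    ext i j
    fin_cases i <;> fin_cases j <;>
      simp [Matrix.mul_apply, Fin.sum_univ_three]⟩

theorem sigmaV_mul_rotZ (θ : ℝ) : sigmaV * rotZ θ = rotZ (-θ) * sigmaV := by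
  refine O3.ext fun i j => ?_
  fin_cases i <;> fin_cases j <;> simp [rotZ, sigmaV]

theorem sigmaV_commute_sigmaH : Commute sigmaV sigmaH := by
  refine O3.ext fun i j => ?_
  fin_cases i <;> fin_cases j <;> simp [sigmaH, sigmaV]

/-- `C_∞h`: the rotations about the `z`-axis and their products with `σ_h`. -/
def Cinfh : Subgroup O3 where
  carrier := {g | ∃ θ, g = rotZ θ ∨ g = rotZ θ * sigmaH}
  one_mem' := ⟨0, Or.inl rotZ_zero.symm⟩
  mul_mem' := by
    rintro a b ⟨θ, ha⟩ ⟨φ, hb⟩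
    refine ⟨θ + φ, ?_⟩
    rw [rotZ_add]
    have h := (rotZ_commute_sigmaH φ).eq
    rcases ha with rfl | rfl <;> rcases hb with rfl | rfl
    · exact Or.inl rfl
    · exact Or.inr (mul_assoc _ _ _).symm
    · right; rw [mul_assoc, ← h, mul_assoc]
    · left
      rw [mul_assoc, ← mul_assoc sigmaH, ← h, mul_assoc, sigmaH_mul_self, mul_one]
  inv_mem' := by
    rintro a ⟨θ, rfl | rfl⟩
    · exact ⟨-θ, Or.inl (rotZ_neg θ).symm⟩
    · refine ⟨-θ, Or.inr ?_⟩
      rw [mul_inv_rev, sigmaH_inv, rotZ_neg, (rotZ_commute_sigmaH θ).inv_left.eq]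

theorem rotZ_mem_Cinfh (θ : ℝ) : rotZ θ ∈ Cinfh := ⟨θ, Or.inl rfl⟩

theorem sigmaH_mem_Cinfh : sigmaH ∈ Cinfh := ⟨0, Or.inr (by rw [rotZ_zero, one_mul])⟩

theorem rotZ_commute_of_mem_Cinfh (θ : ℝ) {g : O3} (hg : g ∈ Cinfh) : Commute (rotZ θ) g := by
  obtain ⟨φ, rfl | rfl⟩ := hg
  · exact rotZ_commute θ φ
  · exact (rotZ_commute θ φ).mul_right (rotZ_commute_sigmaH θ)

theorem exists_rotZ_of_mem_Cinfh {g : O3} (hg : g ∈ Cinfh) (hd : g.1.det = 1) :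
    ∃ θ, g = rotZ θ := by
  obtain ⟨θ, rfl | rfl⟩ := hg
  · exact ⟨θ, rfl⟩
  · rw [det_rotZ_mul_sigmaH] at hd
    norm_num at hd

theorem rotZ_mem_Dinfh (θ : ℝ) : rotZ θ ∈ Dinfh := by
  left
  ext i
  fin_cases i <;> simp [rotZ, ez, Matrix.mulVec, dotProduct, Fin.sum_univ_three]

theorem sigmaH_mem_Dinfh : sigmaH ∈ Dinfh := by
  right
  ext i
  fin_cases i <;> simp [sigmaH, ez, Matrix.mulVec, dotProduct, Fin.sum_univ_three]

/-! ### Matrix description of `Dinfh` -/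

theorem sum_sq_col (g : O3) (j k : Fin 3) :
    g.1 0 j * g.1 0 k + g.1 1 j * g.1 1 k + g.1 2 j * g.1 2 k = if j = k then 1 else 0 := by
  have h := congrFun (congrFun ((Matrix.mem_orthogonalGroup_iff' (Fin 3) ℝ).1 g.2) j) k
  simpa [Matrix.mul_apply, Fin.sum_univ_three, Matrix.one_apply] using h

theorem sum_sq_row (g : O3) (j k : Fin 3) :
    g.1 j 0 * g.1 k 0 + g.1 j 1 * g.1 k 1 + g.1 j 2 * g.1 k 2 = if j = k then 1 else 0 := by
  have h := congrFun (congrFun ((Matrix.mem_orthogonalGroup_iff (Fin 3) ℝ).1 g.2) j) k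
  simpa [Matrix.mul_apply, Fin.sum_univ_three, Matrix.one_apply] using h

theorem mulVec_ez (g : O3) (i : Fin 3) : g.1.mulVec ez i = g.1 i 2 := by
  simp [ez, Matrix.mulVec, dotProduct, Fin.sum_univ_three]

theorem mem_Dinfh_of_col {g : O3} (h0 : g.1 0 2 = 0) (h1 : g.1 1 2 = 0) : g ∈ Dinfh := by
  have h := sum_sq_col g 2 2
  simp only [h0, h1, mul_zero, zero_add, if_true] at h
  rcases mul_self_eq_one_iff.1 h with h2 | h2
  · left
    ext i
    rw [mulVec_ez]
    fin_cases i <;> simp [h0, h1, h2, ez]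
  · right
    ext i
    rw [mulVec_ez]
    fin_cases i <;> simp [h0, h1, h2, ez]

theorem exists_cos_sin_of_sq_add_sq {a c : ℝ} (h : a * a + c * c = 1) :
    ∃ θ, a = Real.cos θ ∧ c = Real.sin θ := by
  have hn : ‖(⟨a, c⟩ : ℂ)‖ = 1 := by
    rw [Complex.norm_def, Complex.normSq_mk, h, Real.sqrt_one]
  obtain ⟨θ, hθ⟩ := (Complex.norm_eq_one_iff _).1 hn
  refine ⟨θ, ?_, ?_⟩
  · have := congrArg Complex.re hθ
    rw [Complex.exp_ofReal_mul_I_re] at this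
    exact this.symm
  · have := congrArg Complex.im hθ
    rw [Complex.exp_ofReal_mul_I_im] at this
    exact this.symm

/-- Fixing the axis makes the matrix block diagonal: an orthogonal 2×2 block and an entry `±1`. The
block's determinant tells whether `sigmaV` occurs, the corner entry whether `sigmaH` does. -/
theorem eq_of_mem_Dinfh {g : O3} (hg : g ∈ Dinfh) :
    ∃ k ∈ Cinfh, g = k ∨ g = k * sigmaV := by
  have hcol : ∀ i, g.1 i 2 = ez i ∨ g.1 i 2 = -ez i := by
    intro i
    rw [← mulVec_ez]
    rcases hg with h | h
    · left; rw [h]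
    · right; rw [h]; rfl
  have h02 : g.1 0 2 = 0 := by simpa [ez] using hcol 0
  have h12 : g.1 1 2 = 0 := by simpa [ez] using hcol 1
  have h22 : g.1 2 2 = 1 ∨ g.1 2 2 = -1 := by simpa [ez] using hcol 2
  have hsq : g.1 2 2 * g.1 2 2 = 1 := by rcases h22 with h | h <;> rw [h] <;> norm_num
  have hrow := sum_sq_row g 2 2
  simp only [if_true] at hrow
  have h20 : g.1 2 0 = 0 := by nlinarith [mul_self_nonneg (g.1 2 0), mul_self_nonneg (g.1 2 1)]
  have h21 : g.1 2 1 = 0 := by nlinarith [mul_self_nonneg (g.1 2 0), mul_self_nonneg (g.1 2 1)]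
  have c00 := sum_sq_col g 0 0
  have c11 := sum_sq_col g 1 1
  have c01 := sum_sq_col g 0 1
  simp [h20, h21] at c00 c11 c01
  obtain ⟨θ, hc, hs⟩ := exists_cos_sin_of_sq_add_sq c00
  -- Lagrange's identity: the squared determinant is the product of the squared column norms minus
  -- the squared inner product.
  have hd : (g.1 0 0 * g.1 1 1 - g.1 0 1 * g.1 1 0) *
      (g.1 0 0 * g.1 1 1 - g.1 0 1 * g.1 1 0) = 1 := by
    linear_combination c11 * (g.1 0 0 * g.1 0 0 + g.1 1 0 * g.1 1 0) + c00
      - c01 * (g.1 0 0 * g.1 0 1 + g.1 1 0 * g.1 1 1)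
  rcases mul_self_eq_one_iff.1 hd with hd | hd
  · have h11 : g.1 1 1 = Real.cos θ := by
      rw [← hc]
      linear_combination -(g.1 1 1) * c00 + g.1 1 0 * c01 + g.1 0 0 * hd
    have h01 : g.1 0 1 = -Real.sin θ := by
      rw [← hs]
      linear_combination -(g.1 0 1) * c00 + g.1 0 0 * c01 - g.1 1 0 * hd
    rcases h22 with h22 | h22
    · refine ⟨rotZ θ, rotZ_mem_Cinfh θ, Or.inl (O3.ext fun i j => ?_)⟩
      fin_cases i <;> fin_cases j <;> simp [rotZ, *]
    · refine ⟨rotZ θ * sigmaH, ⟨θ, Or.inr rfl⟩, Or.inl (O3.ext fun i j => ?_)⟩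
      fin_cases i <;> fin_cases j <;>
        simp [rotZ, sigmaH, *]
  · have h11 : g.1 1 1 = -Real.cos θ := by
      rw [← hc]
      linear_combination -(g.1 1 1) * c00 + g.1 1 0 * c01 + g.1 0 0 * hd
    have h01 : g.1 0 1 = Real.sin θ := by
      rw [← hs]
      linear_combination -(g.1 0 1) * c00 + g.1 0 0 * c01 - g.1 1 0 * hd
    rcases h22 with h22 | h22
    · refine ⟨rotZ θ, rotZ_mem_Cinfh θ, Or.inr (O3.ext fun i j => ?_)⟩
      fin_cases i <;> fin_cases j <;>
        simp [rotZ, sigmaV, *]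
    · refine ⟨rotZ θ * sigmaH, ⟨θ, Or.inr rfl⟩, Or.inr (O3.ext fun i j => ?_)⟩
      fin_cases i <;> fin_cases j <;>
        simp [rotZ, sigmaH, sigmaV, *]

/-! ### Normalizers of subgroups of `Cinfh` -/

/-- A finite subgroup normalized by all rotations about the `z`-axis contains no product of an
element of `C_∞h` with a vertical reflection. -/
theorem le_Cinfh_of_normalizer_eq {A : Subgroup O3} [Finite A]
    (hN : Subgroup.normalizer (A : Set O3) = Dinfh) : A ≤ Cinfh := by
  intro a ha
  have haD : a ∈ Dinfh := hN ▸ Subgroup.le_normalizer ha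
  obtain ⟨k, hk, rfl | rfl⟩ := eq_of_mem_Dinfh haD
  · exact hk
  · exfalso
    have key : ∀ φ : ℝ, rotZ (φ + φ) ∈ A := by
      intro φ
      have hφ : rotZ φ ∈ Subgroup.normalizer (A : Set O3) := hN ▸ rotZ_mem_Dinfh φ
      have h1 := (Subgroup.mem_normalizer_iff.1 hφ _).1 ha
      have h2 : rotZ φ * (k * sigmaV) * (rotZ φ)⁻¹ = rotZ (φ + φ) * (k * sigmaV) := by
        rw [← rotZ_neg, mul_assoc, mul_assoc, sigmaV_mul_rotZ, neg_neg, rotZ_add, mul_assoc,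
          ← mul_assoc k, ← (rotZ_commute_of_mem_Cinfh φ hk).eq, mul_assoc (rotZ φ) k]
      rw [h2] at h1
      exact (Subgroup.mul_mem_cancel_right A ha).1 h1
    have hcard : (Nat.card A : ℝ) ≠ 0 := by exact_mod_cast Nat.card_pos.ne'
    -- This angle puts the rotation by `π / |A|` into `A`; its `|A|`-th power is the rotation by
    -- `π`, not the identity.
    have h3 := key (Real.pi / Nat.card A / 2)
    have h4 : rotZ (Real.pi / Nat.card A / 2 + Real.pi / Nat.card A / 2) ^ Nat.card A = 1 :=
      pow_card_eq_one_of_mem h3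
    rw [rotZ_pow, add_halves, mul_div_cancel₀ _ hcard] at h4
    exact rotZ_pi_ne_one h4

/-- `Cinfh` is abelian and `sigmaV` inverts each of its elements, so conjugation by `Dinfh` sends
`a` to `a` or `a⁻¹`. -/
theorem conj_mem_of_le_Cinfh {A : Subgroup O3} (hA : A ≤ Cinfh) {g : O3} (hg : g ∈ Dinfh) {a : O3}
    (ha : a ∈ A) : g * a * g⁻¹ ∈ A := by
  have hcomm : ∀ x ∈ Cinfh, ∀ y ∈ Cinfh, Commute x y := by
    rintro x ⟨φ, rfl | rfl⟩ y hy
    · exact rotZ_commute_of_mem_Cinfh φ hy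
    · refine (rotZ_commute_of_mem_Cinfh φ hy).mul_left ?_
      obtain ⟨ψ, rfl | rfl⟩ := hy
      · exact (rotZ_commute_sigmaH ψ).symm
      · exact (rotZ_commute_sigmaH ψ).symm.mul_right (Commute.refl _)
  obtain ⟨k, hk, rfl | rfl⟩ := eq_of_mem_Dinfh hg
  · rwa [(hcomm _ hk a (hA ha)).eq, mul_inv_cancel_right]
  · have h1 : sigmaV * a = a⁻¹ * sigmaV := by
      obtain ⟨θ, rfl | rfl⟩ := hA ha
      · rw [sigmaV_mul_rotZ, rotZ_neg]
      · rw [← mul_assoc, sigmaV_mul_rotZ, mul_assoc, sigmaV_commute_sigmaH.eq, mul_inv_rev,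
          sigmaH_inv, ← rotZ_neg, ← mul_assoc, (rotZ_commute_sigmaH _).eq]
    have h2 : k * sigmaV * a * (k * sigmaV)⁻¹ = a⁻¹ := by
      rw [mul_assoc k, h1, ← mul_assoc, (hcomm k hk _ (inv_mem (hA ha))).eq, mul_assoc a⁻¹ k,
        mul_inv_cancel_right]
    rw [h2]
    exact inv_mem ha

theorem Dinfh_le_normalizer {A : Subgroup O3} (hA : A ≤ Cinfh) :
    Dinfh ≤ Subgroup.normalizer (A : Set O3) := by
  intro g hg
  rw [Subgroup.mem_normalizer_iff]
  refine fun a => ⟨conj_mem_of_le_Cinfh hA hg, fun h => ?_⟩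
  have := conj_mem_of_le_Cinfh hA (inv_mem hg) h
  simpa [mul_assoc] using this

theorem mem_Dinfh_of_rotZ_mul_eq {g : O3} {ψ : ℝ} (hψ : rotZ ψ ≠ 1)
    (h : ∃ φ, rotZ ψ * g = g * rotZ φ) :
    g ∈ Dinfh := by
  obtain ⟨φ, h⟩ := h
  have h0 := congrArg (fun x : O3 => x.1 0 2) h
  have h1 := congrArg (fun x : O3 => x.1 1 2) h
  simp [rotZ, Matrix.mul_apply, Fin.sum_univ_three] at h0 h1
  have hcs := Real.sin_sq_add_cos_sq ψ
  -- By `h0` and `h1`, the plane rotation by `ψ` fixes the top two entries of the last column of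
  -- `g`. `2 - 2 * cos ψ` is the determinant of that rotation minus the identity; the combinations
  -- below apply the adjugate.
  have hc : 2 - 2 * Real.cos ψ ≠ 0 := by
    intro hc
    exact hψ (rotZ_eq_one_iff_cos.2 (by linarith))
  refine mem_Dinfh_of_col (mul_left_cancel₀ hc ?_) (mul_left_cancel₀ hc ?_)
  · linear_combination (Real.cos ψ - 1) * h0 + Real.sin ψ * h1 - g.1 0 2 * hcs
  · linear_combination (Real.cos ψ - 1) * h1 - Real.sin ψ * h0 - g.1 1 2 * hcs

theorem exists_rotZ_mem {A : Subgroup O3} (hA : A ≤ Cinfh) (hR : HasNontrivialRotation A) :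
    ∃ θ, rotZ θ ∈ A ∧ rotZ θ ≠ 1 := by
  obtain ⟨a, ha, hd, ha1⟩ := hR
  obtain ⟨θ, rfl⟩ := exists_rotZ_of_mem_Cinfh (hA ha) hd
  exact ⟨θ, ha, ha1⟩

/-- Conjugation preserves determinants, so a normalizing element carries a nontrivial rotation in
`A` to another rotation about the `z`-axis and must preserve that axis. -/
theorem normalizer_eq_Dinfh {A : Subgroup O3} (hA : A ≤ Cinfh) (hR : HasNontrivialRotation A) :
    Subgroup.normalizer (A : Set O3) = Dinfh := by
  refine le_antisymm (fun g hg => ?_) (Dinfh_le_normalizer hA)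
  obtain ⟨θ, hθ, hθ1⟩ := exists_rotZ_mem hA hR
  have h1 := (Subgroup.mem_normalizer_iff.1 hg _).1 hθ
  obtain ⟨ψ, hψ⟩ := exists_rotZ_of_mem_Cinfh (hA h1) (by rw [det_conj, det_rotZ])
  refine mem_Dinfh_of_rotZ_mul_eq (ψ := ψ) ?_ ⟨θ, ?_⟩
  · rw [← hψ]
    simpa using hθ1
  · rw [← hψ, inv_mul_cancel_right]

/-! ### The groups `C n`, `S (2 * n)` and `Ch n` -/

theorem rotZ_two_pi_div_ne_one {n : ℕ} (hn : 2 ≤ n) : rotZ (2 * Real.pi / n) ≠ 1 := by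
  rw [Ne, rotZ_eq_one_iff]
  rintro ⟨k, hk⟩
  have hn0 : (n : ℝ) ≠ 0 := by positivity
  have h1 : ((k * n : ℤ) : ℝ) = (1 : ℤ) := by
    have hpi := Real.pi_pos.ne'
    field_simp at hk
    push_cast
    linarith
  have h2 : (n : ℤ) ∣ 1 := ⟨k, by rw [mul_comm]; exact_mod_cast h1.symm⟩
  have := Int.le_of_dvd one_pos h2
  omega

theorem rotZ_two_pi_div_pow {n : ℕ} (hn : n ≠ 0) : rotZ (2 * Real.pi / n) ^ n = 1 := by
  rw [rotZ_pow, mul_div_cancel₀ _ (by exact_mod_cast hn), rotZ_eq_one_iff]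
  exact ⟨1, by simp⟩

theorem orderOf_rotZ {n : ℕ} (hn : n ≠ 0) : orderOf (rotZ (2 * Real.pi / n)) = n := by
  refine Nat.dvd_antisymm (orderOf_dvd_of_pow_eq_one (rotZ_two_pi_div_pow hn)) ?_
  have h := pow_orderOf_eq_one (rotZ (2 * Real.pi / n))
  rw [rotZ_pow, rotZ_eq_one_iff] at h
  obtain ⟨k, hk⟩ := h
  have hn0 : (n : ℝ) ≠ 0 := by exact_mod_cast hn
  have hpi := Real.pi_pos.ne'
  field_simp at hk
  have hk' : (n : ℤ) * k = orderOf (rotZ (2 * Real.pi / n)) := by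
    have : ((n * k : ℤ) : ℝ) = ((orderOf (rotZ (2 * Real.pi / n)) : ℤ) : ℝ) := by
      push_cast
      linarith
    exact_mod_cast this
  exact Int.natCast_dvd_natCast.1 ⟨k, hk'.symm⟩

theorem card_C {n : ℕ} (hn : n ≠ 0) : Nat.card (C n) = n := by
  rw [C, Nat.card_zpowers, orderOf_rotZ hn]

theorem finite_C {n : ℕ} (hn : n ≠ 0) : Finite (C n) :=
  Nat.finite_of_card_ne_zero (by rwa [card_C hn])

theorem C_le_Cinfh (n : ℕ) : C n ≤ Cinfh := by
  rw [C, Subgroup.zpowers_le]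
  exact rotZ_mem_Cinfh _

theorem S_le_Cinfh (m : ℕ) : S m ≤ Cinfh := by
  rw [S, Subgroup.zpowers_le]
  exact mul_mem sigmaH_mem_Cinfh (rotZ_mem_Cinfh _)

theorem Ch_le_Cinfh (n : ℕ) : Ch n ≤ Cinfh :=
  sup_le (C_le_Cinfh n) (by rw [Subgroup.zpowers_le]; exact sigmaH_mem_Cinfh)

theorem sigmaH_mul_rotZ_sq (θ : ℝ) : (sigmaH * rotZ θ) ^ 2 = rotZ (2 * θ) := by
  rw [(rotZ_commute_sigmaH θ).symm.mul_pow, pow_two, sigmaH_mul_self, one_mul, rotZ_pow]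
  norm_num

theorem rotZ_mem_S (n : ℕ) : rotZ (2 * Real.pi / n) ∈ S (2 * n) := by
  have h : rotZ (2 * Real.pi / n) = (sigmaH * rotZ (2 * Real.pi / (2 * n : ℕ))) ^ 2 := by
    rw [sigmaH_mul_rotZ_sq]
    congr 1
    push_cast
    rw [mul_div_mul_left _ _ two_ne_zero, mul_div_assoc]
  rw [h]
  exact pow_mem (Subgroup.mem_zpowers _) 2

theorem C_le_S (n : ℕ) : C n ≤ S (2 * n) := by
  rw [C, Subgroup.zpowers_le]
  exact rotZ_mem_S n

theorem finite_S {n : ℕ} (hn : n ≠ 0) : Finite (S (2 * n)) := by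
  have h : IsOfFinOrder (sigmaH * rotZ (2 * Real.pi / (2 * n : ℕ))) := by
    refine isOfFinOrder_iff_pow_eq_one.2 ⟨2 * n, by omega, ?_⟩
    rw [(rotZ_commute_sigmaH _).symm.mul_pow, rotZ_two_pi_div_pow (by omega), pow_mul, pow_two,
      sigmaH_mul_self, one_pow, one_mul]
  exact finite_zpowers.2 h

theorem finite_Ch {n : ℕ} (hn : n ≠ 0) : Finite (Ch n) := by
  have h1 : (C n : Set O3).Finite := finite_C hn
  have h2 : (Subgroup.zpowers sigmaH : Set O3).Finite :=
    finite_zpowers.2 (isOfFinOrder_iff_pow_eq_one.2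
      ⟨2, two_pos, by rw [pow_two, sigmaH_mul_self]⟩)
  have hle : Subgroup.zpowers sigmaH ≤ Subgroup.normalizer (C n : Set O3) :=
    Subgroup.zpowers_le.2 (Dinfh_le_normalizer (C_le_Cinfh n) sigmaH_mem_Dinfh)
  have h3 : (Ch n : Set O3) = C n * Subgroup.zpowers sigmaH :=
    Subgroup.coe_mul_of_right_le_normalizer_left _ _ hle
  have h4 : (Ch n : Set O3).Finite := h3 ▸ h1.mul h2
  exact h4

theorem hasNontrivialRotation_of_C_le {n : ℕ} (hn : 2 ≤ n) {A : Subgroup O3} (h : C n ≤ A) :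
    HasNontrivialRotation A :=
  ⟨_, h (Subgroup.mem_zpowers _), det_rotZ _, rotZ_two_pi_div_ne_one hn⟩

/-! ### Classification of the finite subgroups of `Cinfh` -/

/-- The group of all rotations about the `z`-axis. -/
def Cinf : Subgroup O3 where
  carrier := Set.range rotZ
  one_mem' := ⟨0, rotZ_zero⟩
  mul_mem' := by
    rintro _ _ ⟨θ, rfl⟩ ⟨φ, rfl⟩
    exact ⟨θ + φ, rotZ_add θ φ⟩
  inv_mem' := by
    rintro _ ⟨θ, rfl⟩
    exact ⟨-θ, rotZ_neg θ⟩

/-- By Lagrange every angle in `A` is a multiple of `2π / |A|`, so `A` sits inside a group of its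
own order. -/
theorem eq_C_of_le_Cinf {A : Subgroup O3} [Finite A] (hA : A ≤ Cinf) : A = C (Nat.card A) := by
  have hm : Nat.card A ≠ 0 := Nat.card_pos.ne'
  have := finite_C hm
  refine Subgroup.eq_of_le_of_card_ge (fun a ha => ?_) (card_C hm).le
  obtain ⟨θ, rfl⟩ := hA ha
  have h : rotZ θ ^ Nat.card A = 1 := pow_card_eq_one_of_mem ha
  rw [rotZ_pow, rotZ_eq_one_iff] at h
  obtain ⟨k, hk⟩ := h
  refine Subgroup.mem_zpowers_iff.2 ⟨k, ?_⟩
  rw [rotZ_zpow, ← mul_div_assoc, hk, mul_div_cancel_left₀ _ (by exact_mod_cast hm)]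

/-- The classification of the finite subgroups of `C_∞h` with a nontrivial rotation. -/
theorem eq_C_or_S_or_Ch {A : Subgroup O3} [Finite A] (hA : A ≤ Cinfh)
    (hR : HasNontrivialRotation A) :
    ∃ n : ℕ, 2 ≤ n ∧ (A = C n ∨ A = S (2 * n) ∨ A = Ch n) := by
  have hfin : Finite (A ⊓ Cinf : Subgroup O3) :=
    Finite.of_injective _ (Subgroup.inclusion_injective (inf_le_left : A ⊓ Cinf ≤ A))
  obtain ⟨n, hn⟩ : ∃ n, n = Nat.card (A ⊓ Cinf : Subgroup O3) := ⟨_, rfl⟩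
  have hC : A ⊓ Cinf = C n := hn ▸ eq_C_of_le_Cinf inf_le_right
  have hn0 : n ≠ 0 := hn ▸ Nat.card_pos.ne'
  have hn0' : (n : ℝ) ≠ 0 := by exact_mod_cast hn0
  have hCA : C n ≤ A := hC ▸ inf_le_left
  have hmem : ∀ θ, rotZ θ ∈ A → rotZ θ ∈ C n := fun θ h => hC ▸ ⟨h, θ, rfl⟩
  have hn2 : 2 ≤ n := by
    obtain ⟨θ, hθ, hθ1⟩ := exists_rotZ_mem hA hR
    by_contra h
    obtain rfl : n = 1 := by omega
    have h1 := hmem θ hθ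
    rw [C, Subgroup.mem_zpowers_iff] at h1
    obtain ⟨k, hk⟩ := h1
    have h2 := rotZ_two_pi_div_pow one_ne_zero
    rw [pow_one] at h2
    rw [h2, one_zpow] at hk
    exact hθ1 hk.symm
  refine ⟨n, hn2, ?_⟩
  by_cases hAC : A ≤ Cinf
  · left
    rw [← hC, inf_eq_left.2 hAC]
  right
  obtain ⟨a, ha, haC⟩ := Set.not_subset.1 hAC
  obtain ⟨φ, rfl | rfl⟩ := hA ha
  · exact absurd ⟨φ, rfl⟩ haC
  -- `A` is generated by `C n` and any one of its improper elements.
  have hle : ∀ B : Subgroup O3, C n ≤ B → ∀ ψ, rotZ ψ * sigmaH ∈ A → rotZ ψ * sigmaH ∈ B →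
      A ≤ B := by
    intro B hB ψ hψA hψB x hx
    obtain ⟨θ, rfl | rfl⟩ := hA hx
    · exact hB (hmem θ hx)
    · have h1 : rotZ (θ - ψ) * (rotZ ψ * sigmaH) = rotZ θ * sigmaH := by
        rw [← mul_assoc, ← rotZ_add, sub_add_cancel]
      rw [← h1] at hx ⊢
      exact mul_mem (hB (hmem _ ((Subgroup.mul_mem_cancel_right A hψA).1 hx))) hψB
  -- The square of an improper element is a rotation in `A`, hence in `C n`; `l` below counts full
  -- turns.
  have hsq := hmem (2 * φ) (by
    rw [← sigmaH_mul_rotZ_sq, ← (rotZ_commute_sigmaH φ).eq]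
    exact pow_mem ha 2)
  obtain ⟨k, hk⟩ := Subgroup.mem_zpowers_iff.1 hsq
  rw [rotZ_zpow, ← mul_inv_eq_one, ← rotZ_neg, ← rotZ_add, rotZ_eq_one_iff] at hk
  obtain ⟨l, hl⟩ := hk
  -- Modulo `C n`, the angle `φ` is a multiple of `π / n`.
  have hφ : φ = ((k - l * n : ℤ) : ℝ) * (2 * Real.pi / (2 * n : ℕ)) := by
    push_cast
    field_simp at hl ⊢
    linarith
  -- Even: `rotZ φ` lies in `C n`, so `sigmaH` is in `A`. Odd: modulo `C n`, the improper element is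
  -- the generator of `S (2 * n)`.
  rcases Int.even_or_odd' (k - l * n) with ⟨j, hj | hj⟩
  · right
    have h1 : rotZ φ = rotZ (2 * Real.pi / n) ^ j := by
      rw [rotZ_zpow, hφ, hj]
      congr 1
      push_cast
      field_simp
    have h2 : rotZ φ ∈ C n := Subgroup.mem_zpowers_iff.2 ⟨j, h1.symm⟩
    have h3 : sigmaH ∈ A := (Subgroup.mul_mem_cancel_left A (hCA h2)).1 ha
    refine le_antisymm (hle _ le_sup_left φ ha ?_) (sup_le hCA (Subgroup.zpowers_le.2 h3))
    exact mul_mem (le_sup_left (a := C n) h2)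
      (le_sup_right (a := C n) (Subgroup.mem_zpowers sigmaH))
  · left
    have h1 : rotZ φ * sigmaH =
        rotZ (2 * Real.pi / n) ^ j * (sigmaH * rotZ (2 * Real.pi / (2 * n : ℕ))) := by
      rw [← (rotZ_commute_sigmaH _).eq, ← mul_assoc, rotZ_zpow, ← rotZ_add, hφ, hj]
      congr 2
      push_cast
      field_simp
    have h2 : rotZ (2 * Real.pi / n) ^ j ∈ C n := zpow_mem (Subgroup.mem_zpowers _) j
    refine le_antisymm (hle _ (C_le_S n) φ ha ?_) (Subgroup.zpowers_le.2 ?_)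
    · rw [h1]
      exact mul_mem (C_le_S n h2) (Subgroup.mem_zpowers _)
    · rw [h1] at ha
      exact (Subgroup.mul_mem_cancel_left A (hCA h2)).1 ha

/-- The finite groups with normalizer `D_∞h` and a nontrivial rotation. -/
theorem finite_and_normalizer_eq_iff (A : Subgroup O3) :
    (Finite A ∧ Subgroup.normalizer (A : Set O3) = Dinfh ∧ HasNontrivialRotation A) ↔
      ∃ n : ℕ, 2 ≤ n ∧ (A = C n ∨ A = S (2 * n) ∨ A = Ch n) := by
  constructor
  · rintro ⟨hF, hN, hR⟩
    exact eq_C_or_S_or_Ch (le_Cinfh_of_normalizer_eq hN) hR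
  · rintro ⟨n, hn, rfl | rfl | rfl⟩
    · have hR := hasNontrivialRotation_of_C_le hn (le_refl (C n))
      exact ⟨finite_C (by omega), normalizer_eq_Dinfh (C_le_Cinfh n) hR, hR⟩
    · have hR := hasNontrivialRotation_of_C_le hn (C_le_S n)
      exact ⟨finite_S (by omega), normalizer_eq_Dinfh (S_le_Cinfh _) hR, hR⟩
    · have hR := hasNontrivialRotation_of_C_le hn (le_sup_left : C n ≤ Ch n)
      exact ⟨finite_Ch (by omega), normalizer_eq_Dinfh (Ch_le_Cinfh n) hR, hR⟩

/-! ### Transport to an arbitrary axis -/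

theorem finite_conj_inv_smul_iff (g : O3) (A : Subgroup O3) :
    Finite (MulAut.conj g⁻¹ • A : Subgroup O3) ↔ Finite A :=
  (Subgroup.equivSMul (MulAut.conj g⁻¹) A).toEquiv.finite_iff.symm

theorem hasNontrivialRotation_conj_inv_smul_iff (g : O3) (A : Subgroup O3) :
    HasNontrivialRotation (MulAut.conj g⁻¹ • A) ↔ HasNontrivialRotation A := by
  constructor
  · rintro ⟨a, ha, hd, ha1⟩
    exact ⟨g * a * g⁻¹, mem_conj_inv_smul_iff.1 ha, by rwa [det_conj], by simpa using ha1⟩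
  · rintro ⟨a, ha, hd, ha1⟩
    refine ⟨g⁻¹ * a * g, mem_conj_inv_smul_iff.2 (by simpa [mul_assoc] using ha), ?_, ?_⟩
    · rw [← det_conj g]
      simpa [mul_assoc] using hd
    · intro h
      rw [mul_assoc, inv_mul_eq_one] at h
      exact ha1 (by simpa using h)

theorem normalizer_conj_inv_smul_eq_iff (g : O3) (A : Subgroup O3) :
    Subgroup.normalizer ((MulAut.conj g⁻¹ • A : Subgroup O3) : Set O3) = Dinfh ↔
      Subgroup.normalizer (A : Set O3) = MulAut.conj g • Dinfh := by
  rw [conj_smul_normalizer, conj_smul_eq_iff]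

theorem not_hasComplementIn_normalizer {A : Subgroup O3} [hF : Finite A] {g : O3}
    (hN : Subgroup.normalizer (A : Set O3) = MulAut.conj g • Dinfh)
    (hR : HasNontrivialRotation A) :
    ¬ HasComplementIn A (Subgroup.normalizer (A : Set O3)) := by
  have hF' := (finite_conj_inv_smul_iff g A).2 hF
  have hA := le_Cinfh_of_normalizer_eq ((normalizer_conj_inv_smul_eq_iff g A).2 hN)
  obtain ⟨θ, hθ, hθ1⟩ := exists_rotZ_mem hA ((hasNontrivialRotation_conj_inv_smul_iff g A).2 hR)
  have hcard : (Nat.card A : ℝ) ≠ 0 := by exact_mod_cast Nat.card_pos.ne'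
  -- The root divides the angle by `|A|`, then is conjugated back to the axis of `A`.
  refine not_hasComplementIn_of_root Subgroup.le_normalizer (mem_conj_inv_smul_iff.1 hθ)
    (r := g * rotZ (θ / Nat.card A) * g⁻¹) (by simpa using hθ1) ?_ ?_ ?_
  · rw [hN, Subgroup.mem_pointwise_smul_iff_inv_smul_mem, ← map_inv, MulAut.smul_def,
      MulAut.conj_apply]
    simpa [mul_assoc] using rotZ_mem_Dinfh (θ / Nat.card A)
  · rw [conj_pow, rotZ_pow, mul_div_cancel₀ _ hcard]
  · intro s hs
    have h1 : g⁻¹ * s * g ∈ MulAut.conj g⁻¹ • A :=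
      mem_conj_inv_smul_iff.2 (by simpa [mul_assoc] using hs)
    have h2 := (rotZ_commute_of_mem_Cinfh (θ / Nat.card A) (hA h1)).map (MulAut.conj g)
    simpa [mul_assoc] using h2

end Schoenflies

theorem mainTheorem5 :
    (∀ A N : Subgroup Schoenflies.O3,
      Finite A →
      IsConjugateTo N Schoenflies.Dinfh →
      Subgroup.normalizer (A : Set Schoenflies.O3) = N →
      Schoenflies.HasNontrivialRotation A →
        ¬ HasComplementIn A N ∧
        ∀ (X : Type v) [MulAction Schoenflies.O3 X] (B : Set X), ¬ IsIdealEquivariantSBS A B) ∧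
    (∀ A : Subgroup Schoenflies.O3,
      (Finite A ∧
        IsConjugateTo (Subgroup.normalizer (A : Set Schoenflies.O3)) Schoenflies.Dinfh ∧
        Schoenflies.HasNontrivialRotation A) ↔
      ∃ n : ℕ, 2 ≤ n ∧
        (IsConjugateTo A (Schoenflies.C n) ∨
          IsConjugateTo A (Schoenflies.S (2 * n)) ∨
          IsConjugateTo A (Schoenflies.Ch n))) := by
  refine ⟨fun A N hF ⟨g, hg⟩ hN hR => ?_, fun A => ?_⟩
  · have h : ¬ HasComplementIn A (Subgroup.normalizer (A : Set Schoenflies.O3)) :=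
      Schoenflies.not_hasComplementIn_normalizer (hN.trans hg) hR
    exact ⟨hN ▸ h, fun X _ B hB => h hB.hasComplementIn⟩
  · have key : ∀ g : Schoenflies.O3,
        (Finite A ∧ Subgroup.normalizer (A : Set Schoenflies.O3) =
          MulAut.conj g • Schoenflies.Dinfh ∧ Schoenflies.HasNontrivialRotation A) ↔
        ∃ n : ℕ, 2 ≤ n ∧ (A = MulAut.conj g • Schoenflies.C n ∨
          A = MulAut.conj g • Schoenflies.S (2 * n) ∨ A = MulAut.conj g • Schoenflies.Ch n) := by
      intro g
      rw [← Schoenflies.finite_conj_inv_smul_iff g A,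
        ← Schoenflies.normalizer_conj_inv_smul_eq_iff g A,
        ← Schoenflies.hasNontrivialRotation_conj_inv_smul_iff g A,
        Schoenflies.finite_and_normalizer_eq_iff]
      simp only [conj_smul_eq_iff]
    constructor
    · rintro ⟨hF, ⟨g, hg⟩, hR⟩
      obtain ⟨n, hn, h⟩ := (key g).1 ⟨hF, hg, hR⟩
      exact ⟨n, hn, h.imp (fun h => ⟨g, h⟩) (Or.imp (fun h => ⟨g, h⟩) fun h => ⟨g, h⟩)⟩
    · rintro ⟨n, hn, ⟨g, h⟩ | ⟨g, h⟩ | ⟨g, h⟩⟩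
      · obtain ⟨hF, hN, hR⟩ := (key g).2 ⟨n, hn, Or.inl h⟩
        exact ⟨hF, ⟨g, hN⟩, hR⟩
      · obtain ⟨hF, hN, hR⟩ := (key g).2 ⟨n, hn, Or.inr (Or.inl h)⟩
        exact ⟨hF, ⟨g, hN⟩, hR⟩
      · obtain ⟨hF, hN, hR⟩ := (key g).2 ⟨n, hn, Or.inr (Or.inr h)⟩
        exact ⟨hF, ⟨g, hN⟩, hR⟩
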